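/- Let \[ U=\,]0,1[^2\,\cup\,\bigl(\{0\}\times[0,\tfrac12]\bigr)\cup\bigl([0,\tfrac12]\times\{0\}\bigr),\qquad D=\,]0,1[^2\,\cup\,\bigl(]0,\tfrac12]\times\{0\}\bigr)\subset U, \] and let $T:D\to U$ be the natural extension of the Gauss map, \[ T(x,y)=\Bigl(\bigl\{\tfrac1x\bigr\},\ \frac{1}{\lfloor 1/x\rfloor+y}\Bigr), \] where $\lfloor t\rfloor$ and $\{t\}=t-\lfloor t\rfloor$ denote the integer part and the fractional part of $t$. Let \[ d\mu=\frac{dx\,dy}{\ln 2\,(1+xy)^2}\quad\text{on } U . \] Then $\mu$ is a probability measure, the set $U\setminus D=\{0\}\times[0,\tfrac12]$ has $\mu$-measure $0$ (so that $T$ is defined $\mu$-almost everywhere), and $\mu$ is $T$-invariant and ergodic. That is, for every Borel set $A\subset U$ one has $\mu(T^{-1}(A))=\mu(A)$, and if $\mu\bigl(T^{-1}(A)\,\triangle\, A\bigr)=0$ then $\mu(A)\in\{0,1\}$. Equivalently, the self-map of $U$ that equals $T$ on $D$ and the identity on the $\mu$-null set $U\setminus D$ is measure preserving and ergodic with respect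 to $\mu$. -/

import Mathlib

open MeasureTheory

namespace GaussNatExt

/-- The set `U = ]0,1[² ∪ ({0} × [0,1/2]) ∪ ([0,1/2] × {0})` in the plane. -/
def U : Set (ℝ × ℝ) :=
  (Set.Ioo (0 : ℝ) 1 ×ˢ Set.Ioo (0 : ℝ) 1) ∪ (({0} : Set ℝ) ×ˢ Set.Icc (0 : ℝ) (1 / 2)) ∪
    (Set.Icc (0 : ℝ) (1 / 2) ×ˢ ({0} : Set ℝ))

/-- The domain `]0,1[² ∪ (]0,1/2] × {0})` of the natural extension, as a subset of the space `U`. -/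
def dom : Set U :=
  {p | (p : ℝ × ℝ) ∈ (Set.Ioo (0 : ℝ) 1 ×ˢ Set.Ioo (0 : ℝ) 1) ∪
    (Set.Ioc (0 : ℝ) (1 / 2) ×ˢ ({0} : Set ℝ))}

/-- The formula `(x, y) ↦ ({1/x}, 1 / (⌊1/x⌋ + y))`. -/
noncomputable def formula (p : ℝ × ℝ) : ℝ × ℝ :=
  (Int.fract (1 / p.1), 1 / ((⌊1 / p.1⌋ : ℝ) + p.2))

theorem formula_mem (p : U) (hp : p ∈ dom) : formula p ∈ U := by
  obtain ⟨⟨x, y⟩, hU⟩ := p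
  have hx0 : 0 < x := by
    rcases hp with h | h
    · exact h.1.1
    · exact h.1.1
  have hx1 : x < 1 := by
    rcases hp with h | h
    · exact h.1.2
    · exact lt_of_le_of_lt h.1.2 (by norm_num)
  have hy0 : 0 ≤ y := by
    rcases hp with h | h
    · exact h.2.1.le
    · exact (show y = 0 from h.2).ge
  have hinv : 1 < 1 / x := by rw [lt_div_iff₀ hx0]; linarith
  have hfl : (1 : ℤ) ≤ ⌊1 / x⌋ := Int.le_floor.mpr (by exact_mod_cast hinv.le)
  have hfl' : (1 : ℝ) ≤ (⌊1 / x⌋ : ℝ) := by exact_mod_cast hfl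
  have hadd : Int.fract (1 / x) = 1 / x - ⌊1 / x⌋ := rfl
  have hf0 := Int.fract_nonneg (1 / x)
  have hf1 := Int.fract_lt_one (1 / x)
  have hpos : 0 < (⌊1 / x⌋ : ℝ) + y := by linarith
  rcases hf0.eq_or_lt with h0 | h0
  · -- here `1/x` is an integer, and it is at least `2`
    refine Or.inl (Or.inr ⟨h0.symm, ?_, ?_⟩)
    · exact (one_div_pos.mpr hpos).le
    · have h2 : (1 : ℝ) < (⌊1 / x⌋ : ℝ) := by linarith
      have h3 : (2 : ℤ) ≤ ⌊1 / x⌋ := by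
        have : (1 : ℤ) < ⌊1 / x⌋ := by exact_mod_cast h2
        omega
      have h4 : (2 : ℝ) ≤ (⌊1 / x⌋ : ℝ) := by exact_mod_cast h3
      exact one_div_le_one_div_of_le (by norm_num) (by simp only; linarith)
  · refine Or.inl (Or.inl ⟨⟨h0, hf1⟩, one_div_pos.mpr hpos, ?_⟩)
    have h1 : 1 < (⌊1 / x⌋ : ℝ) + y := by
      rcases hp with h | h
      · have : 0 < y := h.2.1
        linarith
      · have hx2 : x ≤ 1 / 2 := h.1.2
        have h5 : (2 : ℝ) ≤ 1 / x := by rw [le_div_iff₀ hx0]; linarith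
        have h3 : (2 : ℤ) ≤ ⌊1 / x⌋ := Int.le_floor.mpr (by exact_mod_cast h5)
        have h4 : (2 : ℝ) ≤ (⌊1 / x⌋ : ℝ) := by exact_mod_cast h3
        linarith
    exact (div_lt_one hpos).mpr h1

/-- The natural extension of the Gauss map, on its domain of definition. -/
noncomputable def T (p : dom) : U := ⟨formula p.1, formula_mem p.1 p.2⟩

open Classical in
/-- The natural extension as a self-map of the whole space `U`. The points of `U` outside the domain
of `T`, namely those of the Lebesgue null segment `{0} × [0,1/2]`, are fixed. -/
noncomputable def Ttotal (p : U) : U := if h : p ∈ dom then T ⟨p, h⟩ else p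

/-- The measure `dx dy / (ln 2 (1 + x y)²)` on `U`. -/
noncomputable def mu : Measure U :=
  ((volume : Measure (ℝ × ℝ)).comap (Subtype.val : U → ℝ × ℝ)).withDensity
    fun p => ENNReal.ofReal (1 / (Real.log 2 * (1 + (p : ℝ × ℝ).1 * (p : ℝ × ℝ).2) ^ 2))

end GaussNatExt

/-! On the square of irrational points, `formula` is a bijection. It shifts the first continued
fraction digit from `x` to `y`, so its inverse is its conjugate by the swap of coordinates. The
Jacobian satisfies `J * density ∘ formula = density` (`jacobian_mul_density`), and change of
variables gives invariance.

Ergodicity is Hopf's argument. Points with the same `x` are brought together exponentially fast by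
the iterates (`dist_iterate_formula_le`). If `A` is almost invariant, its indicator is L¹-close to
`g ∘ formula^[2 * n]` with `g` uniformly continuous. For large `n` such a function hardly depends on
`y`, hence neither does the indicator. The swap preserves the measure and exchanges the map with its
inverse, so the swapped set is almost invariant too and the indicator does not depend on `x` either.
Fubini then makes it constant almost everywhere. The segments added to the open square are null. -/

namespace GaussNatExt

open Set Filter Topology

/-! ### Bijectivity on irrational points -/

/-- The irrational numbers of the open unit interval. -/
def irrUnit : Set ℝ := Ioo 0 1 ∩ {x | Irrational x}

theorem measurableSet_irrUnit : MeasurableSet irrUnit :=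
  measurableSet_Ioo.inter (countable_range _).measurableSet.compl

theorem one_le_floor {x : ℝ} (hx : x ∈ irrUnit) : (1 : ℝ) ≤ ⌊1 / x⌋ := by
  have h : 1 ≤ 1 / x := by
    rw [le_div_iff₀ hx.1.1]
    linarith [hx.1.2]
  exact_mod_cast Int.le_floor.mpr (by exact_mod_cast h)

theorem fract_mem_irrUnit {x : ℝ} (hx : x ∈ irrUnit) : Int.fract (1 / x) ∈ irrUnit := by
  have h : Irrational (Int.fract (1 / x)) := by
    rw [Int.fract, one_div]
    exact (irrational_inv_iff.mpr hx.2).sub_intCast _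
  exact ⟨⟨(Int.fract_nonneg _).lt_of_ne fun h0 => h.ne_zero h0.symm, Int.fract_lt_one _⟩, h⟩

theorem inv_floor_add_mem_irrUnit {x y : ℝ} (hx : x ∈ irrUnit) (hy : y ∈ irrUnit) :
    1 / ((⌊1 / x⌋ : ℝ) + y) ∈ irrUnit := by
  have h1 := one_le_floor hx
  have h0 := hy.1.1
  refine ⟨⟨by positivity, ?_⟩, ?_⟩
  · rw [div_lt_one (by linarith)]
    linarith
  · rw [mem_ofPred_eq, one_div]
    exact irrational_inv_iff.mpr (hy.2.intCast_add _)

theorem formula_mem_irrUnit {p : ℝ × ℝ} (hp : p ∈ irrUnit ×ˢ irrUnit) :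
    formula p ∈ irrUnit ×ˢ irrUnit :=
  ⟨fract_mem_irrUnit hp.1, inv_floor_add_mem_irrUnit hp.1 hp.2⟩

theorem swap_mem_irrUnit {p : ℝ × ℝ} (hp : p ∈ irrUnit ×ˢ irrUnit) :
    p.swap ∈ irrUnit ×ˢ irrUnit := ⟨hp.2, hp.1⟩

/-- Conjugation by the swap of coordinates inverts the natural extension. -/
theorem swap_formula_swap_formula {p : ℝ × ℝ} (hp : p ∈ irrUnit ×ˢ irrUnit) :
    (formula (formula p).swap).swap = p := by
  obtain ⟨x, y⟩ := p
  have hy : y ∈ Ioo (0 : ℝ) 1 := hp.2.1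
  have hfl : ⌊(⌊1 / x⌋ : ℝ) + y⌋ = ⌊1 / x⌋ := by
    rw [Int.floor_intCast_add, Int.floor_eq_zero_iff.mpr ⟨hy.1.le, hy.2⟩, add_zero]
  have hfr : Int.fract ((⌊1 / x⌋ : ℝ) + y) = y := by
    rw [Int.fract_intCast_add, Int.fract_eq_self.mpr ⟨hy.1.le, hy.2⟩]
  simp only [formula, Prod.swap, one_div_one_div, hfl, hfr, Int.floor_add_fract]

theorem formula_swap_formula_swap {p : ℝ × ℝ} (hp : p ∈ irrUnit ×ˢ irrUnit) :
    formula (formula p.swap).swap = p := by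
  have h := swap_formula_swap_formula (swap_mem_irrUnit hp)
  rw [← Prod.swap_inj, h]

theorem injOn_formula : InjOn formula (irrUnit ×ˢ irrUnit) := fun p hp q hq h => by
  rw [← swap_formula_swap_formula hp, h, swap_formula_swap_formula hq]

theorem image_formula (A : Set (ℝ × ℝ)) :
    formula '' (irrUnit ×ˢ irrUnit ∩ formula ⁻¹' A) = irrUnit ×ˢ irrUnit ∩ A := by
  ext q
  constructor
  · rintro ⟨p, ⟨hp, hA⟩, rfl⟩
    exact ⟨formula_mem_irrUnit hp, hA⟩
  · rintro ⟨hq, hA⟩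
    have h := formula_swap_formula_swap hq
    exact ⟨_, ⟨swap_mem_irrUnit (formula_mem_irrUnit (swap_mem_irrUnit hq)),
      by rwa [mem_preimage, h]⟩, h⟩

theorem measurable_formula : Measurable formula := by
  unfold formula
  fun_prop

/-! ### Derivative and invariant density -/

theorem hasFDerivAt_formula {p : ℝ × ℝ} (hp : p ∈ irrUnit ×ˢ irrUnit) :
    HasFDerivAt formula
      (((-(p.1 ^ 2)⁻¹) • ContinuousLinearMap.id ℝ ℝ).prodMap
        ((-(((⌊1 / p.1⌋ : ℝ) + p.2) ^ 2)⁻¹) • ContinuousLinearMap.id ℝ ℝ)) p := by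
  obtain ⟨x, y⟩ := p
  have hx : x ∈ irrUnit := hp.1
  have hy : y ∈ irrUnit := hp.2
  have h1 := one_le_floor hx
  have hy0 : 0 < y := hy.1.1
  have hx0 : x ≠ 0 := hx.1.1.ne'
  set k : ℤ := ⌊1 / x⌋ with hk
  -- As `1 / x` is irrational, it is interior to its unit interval and the floor is locally
  -- constant.
  have hfl : ∀ᶠ q : ℝ × ℝ in 𝓝 (x, y), ⌊1 / q.1⌋ = k := by
    have hc : ContinuousAt (fun q : ℝ × ℝ => 1 / q.1) (x, y) :=
      continuousAt_const.div continuousAt_fst hx0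
    have hlt : (k : ℝ) < 1 / x := by
      have := (fract_mem_irrUnit hx).1.1
      rw [Int.fract] at this
      linarith
    filter_upwards [hc.eventually (Ioo_mem_nhds hlt (Int.lt_floor_add_one (1 / x)))] with q hq
    exact Int.floor_eq_iff.mpr ⟨hq.1.le, hq.2⟩
  have hd1 : HasDerivAt (fun t : ℝ => t⁻¹ - k) (-(x ^ 2)⁻¹) x := (hasDerivAt_inv hx0).sub_const _
  have hd2 : HasDerivAt (fun t : ℝ => ((k : ℝ) + t)⁻¹) (-(((k : ℝ) + y) ^ 2)⁻¹) y := by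
    have := ((hasDerivAt_id y).const_add (k : ℝ)).inv (by simp only [id]; positivity)
    refine this.congr_deriv ?_
    simp [neg_div]
  have hd := HasFDerivAt.prodMap (x, y) hd1.hasFDerivAt hd2.hasFDerivAt
  refine (hd.congr_of_eventuallyEq ?_).congr_fderiv ?_
  · filter_upwards [hfl] with q hq
    simp only [formula, Int.fract, hq]
    simp only [one_div, Prod.map]
  · ext <;> simp

theorem det_prodMap_smul_id (a b : ℝ) :
    ((a • ContinuousLinearMap.id ℝ ℝ).prodMap (b • ContinuousLinearMap.id ℝ ℝ)).det = a * b := by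
  have h : (((a • ContinuousLinearMap.id ℝ ℝ).prodMap (b • ContinuousLinearMap.id ℝ ℝ) :
      ℝ × ℝ →L[ℝ] ℝ × ℝ) : ℝ × ℝ →ₗ[ℝ] ℝ × ℝ) =
      (a • LinearMap.id).prodMap (b • LinearMap.id) := rfl
  rw [ContinuousLinearMap.det, h, LinearMap.det_prodMap]
  simp

/-- The invariant density. -/
noncomputable def density (p : ℝ × ℝ) : ENNReal :=
  ENNReal.ofReal (1 / (Real.log 2 * (1 + p.1 * p.2) ^ 2))

theorem measurable_density : Measurable density := by
  unfold density
  fun_prop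

theorem density_swap (p : ℝ × ℝ) : density p.swap = density p := by
  simp [density, mul_comm p.1]

/-- With `k = ⌊1 / x⌋`, the quantity `1 + xy` at the image point equals `(1 + xy) / (x(k + y))`, and
the Jacobian is the square of `1 / (x(k + y))`, so the extra factors cancel. -/
theorem jacobian_mul_density {p : ℝ × ℝ} (hp : p ∈ irrUnit ×ˢ irrUnit) :
    ENNReal.ofReal |(-(p.1 ^ 2)⁻¹) * (-(((⌊1 / p.1⌋ : ℝ) + p.2) ^ 2)⁻¹)| * density (formula p) =
      density p := by
  obtain ⟨x, y⟩ := p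
  have h1 := one_le_floor hp.1
  have hx0 : 0 < x := hp.1.1.1
  have hy0 : 0 < y := hp.2.1.1
  have hlog : 0 < Real.log 2 := Real.log_pos one_lt_two
  simp only [density, formula, Int.fract] at h1 ⊢
  set k : ℝ := (⌊1 / x⌋ : ℝ)
  rw [← ENNReal.ofReal_mul (abs_nonneg _), neg_mul_neg, abs_of_nonneg (by positivity)]
  congr 1
  have hk : k + y ≠ 0 := by positivity
  have e : 1 + (1 / x - k) * (1 / (k + y)) = (1 + x * y) / (x * (k + y)) := by
    field_simp
    ring
  have : 1 + x * y ≠ 0 := by positivity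
  rw [e]
  field_simp

/-! ### The invariant probability measure on the plane -/

/-- Lebesgue measure on the open unit interval. -/
noncomputable def unitMeasure : Measure ℝ := volume.restrict (Ioo 0 1)

instance : IsProbabilityMeasure unitMeasure := ⟨by simp [unitMeasure]⟩

theorem ae_mem_irrUnit : ∀ᵐ x ∂unitMeasure, x ∈ irrUnit := by
  have h : ∀ᵐ x : ℝ, Irrational x := (countable_range _).ae_notMem _
  filter_upwards [ae_restrict_mem measurableSet_Ioo, ae_restrict_of_ae h] with x h1 h2
  exact ⟨h1, h2⟩

theorem unitMeasure_prod : unitMeasure.prod unitMeasure =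
    (volume : Measure (ℝ × ℝ)).restrict (Ioo 0 1 ×ˢ Ioo 0 1) := by
  rw [unitMeasure, Measure.prod_restrict, ← Measure.volume_eq_prod]

theorem ae_mem_irrUnit_prod : ∀ᵐ p ∂unitMeasure.prod unitMeasure, p ∈ irrUnit ×ˢ irrUnit := by
  have h1 := (Measure.quasiMeasurePreserving_fst (μ := unitMeasure) (ν := unitMeasure)).ae
    ae_mem_irrUnit
  have h2 := (Measure.quasiMeasurePreserving_snd (μ := unitMeasure) (ν := unitMeasure)).ae
    ae_mem_irrUnit
  filter_upwards [h1, h2] with p h1 h2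
  exact ⟨h1, h2⟩

theorem unitMeasure_prod_eq_restrict_irrUnit : unitMeasure.prod unitMeasure =
    (volume : Measure (ℝ × ℝ)).restrict (irrUnit ×ˢ irrUnit) := by
  have h := Measure.restrict_eq_self_of_ae_mem ae_mem_irrUnit_prod
  rw [← h, unitMeasure_prod, Measure.restrict_restrict
    (measurableSet_irrUnit.prod measurableSet_irrUnit), inter_eq_left.mpr]
  exact prod_mono inter_subset_left inter_subset_left

/-- The invariant measure, on the plane. -/
noncomputable def planeMeasure : Measure (ℝ × ℝ) :=
  (unitMeasure.prod unitMeasure).withDensity density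

theorem planeMeasure_apply {A : Set (ℝ × ℝ)} (hA : MeasurableSet A) :
    planeMeasure A = ∫⁻ p in irrUnit ×ˢ irrUnit ∩ A, density p := by
  rw [planeMeasure, withDensity_apply _ hA, unitMeasure_prod_eq_restrict_irrUnit,
    Measure.restrict_restrict hA, inter_comm]

theorem measurePreserving_formula : MeasurePreserving formula planeMeasure planeMeasure := by
  refine ⟨measurable_formula, ?_⟩
  ext A hA
  have hm : MeasurableSet (irrUnit ×ˢ irrUnit ∩ formula ⁻¹' A) :=
    (measurableSet_irrUnit.prod measurableSet_irrUnit).inter (measurable_formula hA)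
  rw [Measure.map_apply measurable_formula hA, planeMeasure_apply hA,
    planeMeasure_apply (measurable_formula hA), ← image_formula A,
    lintegral_image_eq_lintegral_abs_det_fderiv_mul volume hm
      (fun p hp => (hasFDerivAt_formula hp.1).hasFDerivWithinAt)
      (injOn_formula.mono inter_subset_left)]
  refine setLIntegral_congr_fun hm fun p hp => ?_
  simp only [det_prodMap_smul_id]
  exact (jacobian_mul_density hp.1).symm

theorem measurePreserving_swap : MeasurePreserving Prod.swap planeMeasure planeMeasure := by
  refine ⟨measurable_swap, ?_⟩
  ext A hA
  rw [Measure.map_apply measurable_swap hA, planeMeasure, withDensity_apply _ hA,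
    withDensity_apply _ (measurable_swap hA)]
  have h := (Measure.measurePreserving_swap (μ := unitMeasure) (ν := unitMeasure)).setLIntegral_comp_preimage
    hA measurable_density
  rw [← h]
  simp only [density_swap]

theorem lintegral_inv_one_add_mul_sq {x : ℝ} (hx : 0 < x) :
    ∫⁻ y, density (x, y) ∂unitMeasure = ENNReal.ofReal (1 / (Real.log 2 * (1 + x))) := by
  have hlog : 0 < Real.log 2 := Real.log_pos one_lt_two
  have hpos : ∀ y ∈ Icc (0 : ℝ) 1, 0 < 1 + x * y := fun y hy => by
    have := mul_nonneg hx.le hy.1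
    linarith
  have hd : ∀ y ∈ uIcc (0 : ℝ) 1, HasDerivAt (fun y => y / (Real.log 2 * (1 + x * y)))
      (1 / (Real.log 2 * (1 + x * y) ^ 2)) y := fun y hy => by
    rw [uIcc_of_le zero_le_one] at hy
    have h0 := (hpos y hy).ne'
    have h1 : HasDerivAt (fun y => Real.log 2 * (1 + x * y)) (Real.log 2 * (x * 1)) y :=
      (((hasDerivAt_id y).const_mul x).const_add 1).const_mul _
    refine ((hasDerivAt_id y).div h1 (by positivity)).congr_deriv ?_
    simp only [id]
    field_simp
    ring
  have hc : ContinuousOn (fun y => 1 / (Real.log 2 * (1 + x * y) ^ 2)) (Icc 0 1) := by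
    refine continuousOn_const.div (by fun_prop) fun y hy => ?_
    have := hpos y hy
    positivity
  have hi : IntegrableOn (fun y => 1 / (Real.log 2 * (1 + x * y) ^ 2)) (Ioc 0 1) :=
    (hc.integrableOn_Icc).mono_set Ioc_subset_Icc_self
  rw [unitMeasure, restrict_Ioo_eq_restrict_Ioc]
  simp only [density]
  rw [← ofReal_integral_eq_lintegral_ofReal hi, ← intervalIntegral.integral_of_le zero_le_one,
    intervalIntegral.integral_eq_sub_of_hasDerivAt hd]
  · simp
  · exact (intervalIntegrable_iff_integrableOn_Ioc_of_le zero_le_one).mpr hi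
  · exact Eventually.of_forall fun y => by positivity

theorem lintegral_inv_one_add :
    ∫⁻ x, ENNReal.ofReal (1 / (Real.log 2 * (1 + x))) ∂unitMeasure = 1 := by
  have hlog : 0 < Real.log 2 := Real.log_pos one_lt_two
  have hd : ∀ x ∈ uIcc (0 : ℝ) 1, HasDerivAt (fun x => Real.log (1 + x) / Real.log 2)
      (1 / (Real.log 2 * (1 + x))) x := fun x hx => by
    rw [uIcc_of_le zero_le_one] at hx
    have h0 : (1 + x) ≠ 0 := by linarith [hx.1]
    refine ((((hasDerivAt_id x).const_add 1).log h0).div_const _).congr_deriv ?_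
    simp only [id]
    field_simp
  have hc : ContinuousOn (fun x => 1 / (Real.log 2 * (1 + x))) (Icc 0 1) := by
    refine continuousOn_const.div (by fun_prop) fun x hx => ?_
    have : 0 < 1 + x := by linarith [hx.1]
    positivity
  have hi : IntegrableOn (fun x => 1 / (Real.log 2 * (1 + x))) (Ioc 0 1) :=
    (hc.integrableOn_Icc).mono_set Ioc_subset_Icc_self
  rw [unitMeasure, restrict_Ioo_eq_restrict_Ioc,
    ← ofReal_integral_eq_lintegral_ofReal hi, ← intervalIntegral.integral_of_le zero_le_one,
    intervalIntegral.integral_eq_sub_of_hasDerivAt hd]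
  · norm_num [hlog.ne']
  · exact (intervalIntegrable_iff_integrableOn_Ioc_of_le zero_le_one).mpr hi
  · filter_upwards [ae_restrict_mem measurableSet_Ioc] with x hx
    have : 0 < 1 + x := by linarith [hx.1]
    simp only [Pi.zero_apply]
    positivity

instance isProbabilityMeasure_planeMeasure : IsProbabilityMeasure planeMeasure := by
  constructor
  rw [planeMeasure, withDensity_apply _ MeasurableSet.univ, Measure.restrict_univ,
    lintegral_prod _ measurable_density.aemeasurable, ← lintegral_inv_one_add]
  refine lintegral_congr_ae ?_
  filter_upwards [ae_mem_irrUnit] with x hx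
  exact lintegral_inv_one_add_mul_sq hx.1.1

/-- The density is at least 1/4, because `ln 2 ≤ 1` and `(1 + xy)² < 4`. This carries L¹ estimates
over to the product measure, whose marginals are available for Fubini. -/
theorem lintegral_unitMeasure_prod_le {f : ℝ × ℝ → ENNReal} (hf : Measurable f) :
    ∫⁻ p, f p ∂unitMeasure.prod unitMeasure ≤ 4 * ∫⁻ p, f p ∂planeMeasure := by
  rw [planeMeasure, lintegral_withDensity_eq_lintegral_mul _ measurable_density hf,
    ← lintegral_const_mul _ (measurable_density.mul hf)]
  refine lintegral_mono_ae ?_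
  filter_upwards [ae_mem_irrUnit_prod] with p hp
  have hlog : 0 < Real.log 2 := Real.log_pos one_lt_two
  have hlog' : Real.log 2 ≤ 1 := by linarith [Real.log_two_lt_d9]
  have hx := hp.1.1
  have hy := hp.2.1
  have hxy : 0 < p.1 * p.2 := mul_pos hx.1 hy.1
  have hxy' : p.1 * p.2 < 1 := mul_lt_one_of_nonneg_of_lt_one_left hx.1.le hx.2 hy.2.le
  have h : (1 : ENNReal) ≤ 4 * density p := by
    rw [density, ← ENNReal.ofReal_ofNat, ← ENNReal.ofReal_mul (by norm_num), ENNReal.one_le_ofReal,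
      mul_one_div, one_le_div (by positivity)]
    nlinarith
  calc f p = 1 * f p := (one_mul _).symm
    _ ≤ 4 * density p * f p := by gcongr
    _ = 4 * (density * f) p := mul_assoc _ _ _

theorem planeMeasure_absolutelyContinuous :
    planeMeasure ≪ unitMeasure.prod unitMeasure := withDensity_absolutelyContinuous _ _

/-! ### Ergodicity by Hopf's argument -/

theorem abs_inv_add_inv_add_sub_le {a b y z : ℝ} (ha : 1 ≤ a) (hb : 1 ≤ b) (hy : 0 ≤ y)
    (hz : 0 ≤ z) : |1 / (b + 1 / (a + y)) - 1 / (b + 1 / (a + z))| ≤ 1 / 4 * |y - z| := by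
  have h : 1 / (b + 1 / (a + y)) - 1 / (b + 1 / (a + z)) =
      (y - z) / ((b * (a + y) + 1) * (b * (a + z) + 1)) := by
    field_simp
    ring
  -- The two factors yield the rate 1/4. Two iterations are needed: one step `y ↦ 1 / (a + y)` has
  -- derivative near `-1` when `a = 1` and `y` is near 0.
  have h1 : 2 ≤ b * (a + y) + 1 := by nlinarith
  have h2 : 2 ≤ b * (a + z) + 1 := by nlinarith
  have h3 : 4 ≤ (b * (a + y) + 1) * (b * (a + z) + 1) := by nlinarith
  rw [h, abs_div, abs_of_pos (by positivity : 0 < (b * (a + y) + 1) * (b * (a + z) + 1)),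
    div_le_iff₀ (by positivity)]
  nlinarith [abs_nonneg (y - z)]

theorem dist_iterate_formula_le (n : ℕ) : ∀ {x y z : ℝ}, x ∈ irrUnit → y ∈ irrUnit → z ∈ irrUnit →
    dist (formula^[2 * n] (x, y)) (formula^[2 * n] (x, z)) ≤ (1 / 4) ^ n * |y - z| := by
  induction n with
  | zero => intro x y z _ _ _; simp [Prod.dist_eq, Real.dist_eq]
  | succ n ih =>
    intro x y z hx hy hz
    have hy2 := formula_mem_irrUnit (formula_mem_irrUnit (p := (x, y)) ⟨hx, hy⟩)
    have hz2 := formula_mem_irrUnit (formula_mem_irrUnit (p := (x, z)) ⟨hx, hz⟩)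
    rw [show 2 * (n + 1) = 2 * n + 1 + 1 by ring]
    simp only [Function.iterate_succ_apply]
    refine (ih hy2.1 hy2.2 hz2.2).trans ?_
    rw [pow_succ, mul_assoc]
    gcongr
    exact abs_inv_add_inv_add_sub_le (one_le_floor hx) (one_le_floor (fract_mem_irrUnit hx))
      hy.1.1.le hz.1.1.le

/-- The indicator of a set that is almost invariant does not depend on the contracted coordinate. -/
theorem ae_mem_iff_mem_of_preimage_ae_eq {A : Set (ℝ × ℝ)} (hA : MeasurableSet A)
    (hinv : formula ⁻¹' A =ᵐ[planeMeasure] A) :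
    ∀ᵐ q ∂unitMeasure.prod (unitMeasure.prod unitMeasure),
      ((q.1, q.2.1) ∈ A ↔ (q.1, q.2.2) ∈ A) := by
  set f : ℝ × ℝ → ℝ := A.indicator 1 with hf
  have hfm : Measurable f := measurable_one.indicator hA
  have hm1 : MeasurePreserving (fun q : ℝ × ℝ × ℝ => (q.1, q.2.1))
      (unitMeasure.prod (unitMeasure.prod unitMeasure)) (unitMeasure.prod unitMeasure) :=
    (MeasurePreserving.id unitMeasure).prod measurePreserving_fst
  have hm2 : MeasurePreserving (fun q : ℝ × ℝ × ℝ => (q.1, q.2.2))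
      (unitMeasure.prod (unitMeasure.prod unitMeasure)) (unitMeasure.prod unitMeasure) :=
    (MeasurePreserving.id unitMeasure).prod measurePreserving_snd
  -- Replacing the indicator by `g ∘ Φ` costs `4 * ε` at each of the two points; the middle `ε` is
  -- the variation of `g ∘ Φ` between them.
  have hbound : ∀ ε : NNReal, 0 < ε → ∫⁻ q, ‖f (q.1, q.2.1) - f (q.1, q.2.2)‖ₑ
      ∂unitMeasure.prod (unitMeasure.prod unitMeasure) ≤ 4 * ε + ε + 4 * ε := by
    intro ε hε
    obtain ⟨g, hgs, hgi, hgc, -⟩ := Integrable.exists_hasCompactSupport_lintegral_sub_le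
      (μ := planeMeasure) ((integrable_const (1 : ℝ)).indicator hA)
      (ENNReal.coe_ne_zero.mpr hε.ne')
    obtain ⟨δ, hδ, hgδ⟩ := Metric.uniformContinuous_iff.mp
      (hgs.uniformContinuous_of_continuous hgc) ε hε
    obtain ⟨n, hn⟩ := exists_pow_lt_of_lt_one hδ (by norm_num : (1 / 4 : ℝ) < 1)
    set Φ := formula^[2 * n]
    have hΦm : MeasurePreserving Φ planeMeasure planeMeasure :=
      measurePreserving_formula.iterate _
    have hΦA : Φ ⁻¹' A =ᵐ[planeMeasure] A :=
      measurePreserving_formula.quasiMeasurePreserving.preimage_iterate_ae_eq _ hinv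
    have hdm : Measurable fun p => ‖f p - g (Φ p)‖ₑ :=
      (hfm.sub (hgc.measurable.comp hΦm.measurable)).enorm
    have hfg : ∫⁻ p, ‖f p - g (Φ p)‖ₑ ∂unitMeasure.prod unitMeasure ≤ 4 * ε := by
      refine (lintegral_unitMeasure_prod_le hdm).trans (mul_le_mul_right ?_ _)
      refine le_trans (le_of_eq ?_) hgi
      have hdm' : Measurable fun p => ‖f p - g p‖ₑ := (hfm.sub hgc.measurable).enorm
      -- Almost everywhere `f = f ∘ Φ`, so the integrand is `‖f - g‖ₑ` composed with the
      -- measure-preserving `Φ`.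
      refine Eq.trans (lintegral_congr_ae ?_) (hΦm.lintegral_comp hdm')
      filter_upwards [hΦA.mem_iff] with p hp
      rw [mem_preimage] at hp
      by_cases h : p ∈ A
      · simp [hf, h, hp.mpr h]
      · simp [hf, h, mt hp.mp h]
    have hclose : ∀ᵐ q ∂unitMeasure.prod (unitMeasure.prod unitMeasure),
        ‖g (Φ (q.1, q.2.1)) - g (Φ (q.1, q.2.2))‖ₑ ≤ ε := by
      filter_upwards [hm1.quasiMeasurePreserving.ae ae_mem_irrUnit_prod,
        hm2.quasiMeasurePreserving.ae ae_mem_irrUnit_prod] with q h1 h2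
      have hyz : |q.2.1 - q.2.2| ≤ 1 := abs_le.mpr
        ⟨by linarith [h1.2.1.1, h2.2.1.2], by linarith [h1.2.1.2, h2.2.1.1]⟩
      have hd : dist (Φ (q.1, q.2.1)) (Φ (q.1, q.2.2)) < δ :=
        ((dist_iterate_formula_le n h1.1 h1.2 h2.2).trans
          (mul_le_of_le_one_right (by positivity) hyz)).trans_lt hn
      have := (hgδ hd).le
      rw [Real.dist_eq, ← Real.norm_eq_abs] at this
      rw [enorm_eq_nnnorm]
      exact_mod_cast this
    calc ∫⁻ q, ‖f (q.1, q.2.1) - f (q.1, q.2.2)‖ₑ ∂unitMeasure.prod (unitMeasure.prod unitMeasure)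
        ≤ ∫⁻ q, (‖f (q.1, q.2.1) - g (Φ (q.1, q.2.1))‖ₑ + ε) +
            ‖f (q.1, q.2.2) - g (Φ (q.1, q.2.2))‖ₑ
            ∂unitMeasure.prod (unitMeasure.prod unitMeasure) := by
          refine lintegral_mono_ae ?_
          filter_upwards [hclose] with q hq
          rw [show f (q.1, q.2.1) - f (q.1, q.2.2) = (f (q.1, q.2.1) - g (Φ (q.1, q.2.1)) +
            (g (Φ (q.1, q.2.1)) - g (Φ (q.1, q.2.2)))) -
              (f (q.1, q.2.2) - g (Φ (q.1, q.2.2))) by ring]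
          refine enorm_sub_le.trans (add_le_add_left ?_ _)
          exact (enorm_add_le _ _).trans (by gcongr)
      _ = ∫⁻ p, ‖f p - g (Φ p)‖ₑ ∂unitMeasure.prod unitMeasure + ε +
            ∫⁻ p, ‖f p - g (Φ p)‖ₑ ∂unitMeasure.prod unitMeasure := by
          rw [lintegral_add_right _ (show Measurable fun q : ℝ × ℝ × ℝ =>
              ‖f (q.1, q.2.2) - g (Φ (q.1, q.2.2))‖ₑ from hdm.comp hm2.measurable),
            lintegral_add_right _ measurable_const, lintegral_const, measure_univ, mul_one]
          exact congrArg₂ (fun a b : ENNReal => a + ε + b) (hm1.lintegral_comp hdm)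
            (hm2.lintegral_comp hdm)
      _ ≤ 4 * ε + ε + 4 * ε := by gcongr
  have hzero : ∫⁻ q, ‖f (q.1, q.2.1) - f (q.1, q.2.2)‖ₑ
      ∂unitMeasure.prod (unitMeasure.prod unitMeasure) = 0 := by
    refine le_antisymm (ENNReal.le_of_forall_pos_le_add fun ε hε _ => ?_) zero_le
    refine (hbound (ε / 9) (by positivity)).trans (le_of_eq ?_)
    norm_cast
    rw [zero_add]
    field_simp
    norm_num
  rw [lintegral_eq_zero_iff (show Measurable fun q : ℝ × ℝ × ℝ =>
    ‖f (q.1, q.2.1) - f (q.1, q.2.2)‖ₑ from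
      ((hfm.comp hm1.measurable).sub (hfm.comp hm2.measurable)).enorm)] at hzero
  filter_upwards [hzero] with q hq
  have h : f (q.1, q.2.1) = f (q.1, q.2.2) := by
    simpa [sub_eq_zero] using hq
  by_cases h1 : (q.1, q.2.1) ∈ A <;> by_cases h2 : (q.1, q.2.2) ∈ A <;> simp_all

/-- A set almost invariant under an invertible map is almost invariant under the inverse, which the
swap conjugates back to `formula`. -/
theorem swap_preimage_ae_invariant {A : Set (ℝ × ℝ)}
    (hinv : formula ⁻¹' A =ᵐ[planeMeasure] A) :
    formula ⁻¹' (Prod.swap ⁻¹' A) =ᵐ[planeMeasure] Prod.swap ⁻¹' A := by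
  have hq := measurePreserving_swap.quasiMeasurePreserving.ae
    (measurePreserving_formula.quasiMeasurePreserving.ae
      (measurePreserving_swap.quasiMeasurePreserving.ae hinv.mem_iff))
  have hq' := measurePreserving_swap.quasiMeasurePreserving.ae hq
  filter_upwards [hq', planeMeasure_absolutelyContinuous ae_mem_irrUnit_prod] with p hp hI
  have h := formula_swap_formula_swap (swap_mem_irrUnit hI)
  rw [Prod.swap_swap] at h hp
  rw [mem_preimage, h] at hp
  exact propext hp.symm

theorem eventuallyConst_of_preimage_ae_eq {A : Set (ℝ × ℝ)} (hA : MeasurableSet A)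
    (hinv : formula ⁻¹' A =ᵐ[planeMeasure] A) :
    planeMeasure A = 0 ∨ planeMeasure Aᶜ = 0 := by
  have h1 := ae_mem_iff_mem_of_preimage_ae_eq hA hinv
  have h2 := ae_mem_iff_mem_of_preimage_ae_eq (measurable_swap hA)
    (swap_preimage_ae_invariant hinv)
  set l := unitMeasure
  have hm1 : MeasurePreserving (fun r : (ℝ × ℝ) × (ℝ × ℝ) => (r.1.1, r.1.2, r.2.2))
      ((l.prod l).prod (l.prod l)) (l.prod (l.prod l)) :=
    ((MeasurePreserving.id l).prod ((MeasurePreserving.id l).prod measurePreserving_snd)).comp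
      (measurePreserving_prodAssoc l l (l.prod l))
  have hm2 : MeasurePreserving (fun r : (ℝ × ℝ) × (ℝ × ℝ) => (r.2.2, r.2.1, r.1.1))
      ((l.prod l).prod (l.prod l)) (l.prod (l.prod l)) :=
    (hm1.comp (Measure.measurePreserving_swap.prod Measure.measurePreserving_swap)).comp
      Measure.measurePreserving_swap
  -- From `(x, y)` to `(x', y')` through the corner `(x, y')`: `h1` changes the second coordinate,
  -- `h2` the first.
  have h : ∀ᵐ r ∂(l.prod l).prod (l.prod l), (r.1 ∈ A ↔ r.2 ∈ A) := by
    filter_upwards [hm1.quasiMeasurePreserving.ae h1, hm2.quasiMeasurePreserving.ae h2] with r h1 h2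
    exact h1.trans h2.symm
  obtain ⟨p, hp⟩ := (Measure.ae_ae_of_ae_prod h).exists
  by_cases hpA : p ∈ A
  · right
    refine planeMeasure_absolutelyContinuous ?_
    filter_upwards [hp] with q hq
    exact hq.mp hpA
  · left
    refine planeMeasure_absolutelyContinuous (measure_eq_zero_iff_ae_notMem.mpr ?_)
    filter_upwards [hp] with q hq
    exact fun hc => hpA (hq.mpr hc)

/-! ### Transfer from the plane to `U` and `dom` -/

theorem measurableSet_U : MeasurableSet U :=
  ((measurableSet_Ioo.prod measurableSet_Ioo).union
    ((measurableSet_singleton 0).prod measurableSet_Icc)).union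
    (measurableSet_Icc.prod (measurableSet_singleton 0))

theorem measurableSet_dom : MeasurableSet dom :=
  measurable_subtype_coe ((measurableSet_Ioo.prod measurableSet_Ioo).union
    (measurableSet_Ioc.prod (measurableSet_singleton 0)))

theorem U_ae_eq : U =ᵐ[volume] (Ioo (0 : ℝ) 1 ×ˢ Ioo (0 : ℝ) 1 : Set (ℝ × ℝ)) := by
  have h1 : volume (({0} : Set ℝ) ×ˢ Icc (0 : ℝ) (1 / 2)) = 0 := by
    rw [Measure.volume_eq_prod, Measure.prod_prod, Real.volume_singleton, zero_mul]
  have h2 : volume (Icc (0 : ℝ) (1 / 2) ×ˢ ({0} : Set ℝ)) = 0 := by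
    rw [Measure.volume_eq_prod, Measure.prod_prod, Real.volume_singleton, mul_zero]
  exact (union_ae_eq_left_of_ae_eq_empty (ae_eq_empty.mpr h2)).trans
    (union_ae_eq_left_of_ae_eq_empty (ae_eq_empty.mpr h1))

theorem measurePreserving_coe_U : MeasurePreserving ((↑) : U → ℝ × ℝ) mu planeMeasure := by
  refine ⟨measurable_subtype_coe, ?_⟩
  ext B hB
  rw [Measure.map_apply measurable_subtype_coe hB, mu,
    withDensity_apply _ (measurable_subtype_coe hB), planeMeasure, withDensity_apply _ hB,
    unitMeasure_prod, ← Measure.restrict_congr_set U_ae_eq, ← map_comap_subtype_coe measurableSet_U,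
    setLIntegral_map hB measurable_density measurable_subtype_coe]
  rfl

instance isProbabilityMeasure_mu : IsProbabilityMeasure mu :=
  ⟨by rw [← preimage_univ (f := ((↑) : U → ℝ × ℝ)),
    measurePreserving_coe_U.measure_preimage MeasurableSet.univ.nullMeasurableSet, measure_univ]⟩

theorem ae_mem_dom : ∀ᵐ p ∂mu, p ∈ dom := by
  filter_upwards [measurePreserving_coe_U.quasiMeasurePreserving.ae
    (planeMeasure_absolutelyContinuous ae_mem_irrUnit_prod)] with p hp
  exact Or.inl ⟨hp.1.1, hp.2.1⟩

theorem measurePreserving_coe_dom :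
    MeasurePreserving ((↑) : dom → U) (mu.comap ((↑) : dom → U)) mu :=
  ⟨measurable_subtype_coe, by
    rw [map_comap_subtype_coe measurableSet_dom, Measure.restrict_eq_self_of_ae_mem ae_mem_dom]⟩

theorem measurable_T : Measurable T :=
  (measurable_formula.comp (measurable_subtype_coe.comp measurable_subtype_coe)).subtype_mk

theorem measurePreserving_T : MeasurePreserving T (mu.comap ((↑) : dom → U)) mu := by
  refine ⟨measurable_T, ?_⟩
  have hU := MeasurableEmbedding.subtype_coe measurableSet_U
  have h := (measurePreserving_formula.comp
    (measurePreserving_coe_U.comp measurePreserving_coe_dom)).map_eq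
  have h' : (Measure.map T (mu.comap ((↑) : dom → U))).map ((↑) : U → ℝ × ℝ) =
      mu.map ((↑) : U → ℝ × ℝ) := by
    rw [Measure.map_map measurable_subtype_coe measurable_T, measurePreserving_coe_U.map_eq]
    exact h
  -- Pushing forward along a measurable embedding is injective on measures, so equality in the plane
  -- suffices.
  rw [← hU.comap_map (Measure.map T _), h', hU.comap_map]

theorem Ttotal_coe (p : dom) : Ttotal p = T p := dif_pos p.2

theorem measurable_Ttotal : Measurable Ttotal := by
  classical
  exact Measurable.dite measurable_T measurable_subtype_coe measurableSet_dom

theorem measurePreserving_Ttotal : MeasurePreserving Ttotal mu mu := by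
  refine ⟨measurable_Ttotal, ?_⟩
  have h : Measure.map Ttotal (Measure.map ((↑) : dom → U) (mu.comap ((↑) : dom → U))) = mu := by
    rw [Measure.map_map measurable_Ttotal measurable_subtype_coe,
      show Ttotal ∘ ((↑) : dom → U) = T from funext Ttotal_coe, measurePreserving_T.map_eq]
  rwa [measurePreserving_coe_dom.map_eq] at h

theorem measure_eq_zero_or_one_of_ae_invariant {A : Set U} (hA : MeasurableSet A)
    (hinv : ∀ᵐ p ∂mu.comap ((↑) : dom → U), (T p ∈ A ↔ (p : U) ∈ A)) :
    mu A = 0 ∨ mu A = 1 := by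
  have hU := MeasurableEmbedding.subtype_coe measurableSet_U
  set B : Set (ℝ × ℝ) := (↑) '' A with hBdef
  have hB : MeasurableSet B := hU.measurableSet_image' hA
  have hAB : ∀ p : U, (p : ℝ × ℝ) ∈ B ↔ p ∈ A := fun p =>
    Subtype.val_injective.mem_set_image
  have hBinv : formula ⁻¹' B =ᵐ[planeMeasure] B := by
    have hcomp := measurePreserving_coe_U.comp measurePreserving_coe_dom
    have hm : MeasurableSet {q : ℝ × ℝ | formula q ∈ B ↔ q ∈ B} :=
      (measurable_formula hB).iff hB
    have h : ∀ᵐ q ∂planeMeasure, (formula q ∈ B ↔ q ∈ B) := by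
      rw [← hcomp.map_eq, ae_map_iff hcomp.measurable.aemeasurable hm]
      filter_upwards [hinv] with p hp
      exact (hAB (T p)).trans (hp.trans (hAB p).symm)
    filter_upwards [h] with q hq
    exact propext hq
  have hmeas : mu A = planeMeasure B := by
    rw [← measurePreserving_coe_U.measure_preimage hB.nullMeasurableSet, hBdef,
      preimage_image_eq _ Subtype.val_injective]
  rw [hmeas]
  exact (eventuallyConst_of_preimage_ae_eq hB hBinv).imp_right (prob_compl_eq_zero_iff hB).mp

theorem ergodic_Ttotal : Ergodic Ttotal mu := by
  refine ⟨measurePreserving_Ttotal, ⟨fun {A} hA hinv => ?_⟩⟩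
  rw [eventuallyConst_set', ae_eq_empty, ae_eq_univ]
  refine (measure_eq_zero_or_one_of_ae_invariant hA (Eventually.of_forall fun p => ?_)).imp_right
    (prob_compl_eq_zero_iff hA).mpr
  rw [← Ttotal_coe, ← mem_preimage, hinv]

end GaussNatExt

theorem mainTheorem4 :
    -- `mu` is a probability measure
    IsProbabilityMeasure GaussNatExt.mu ∧
    -- `T` is defined almost everywhere
    (∀ᵐ p ∂GaussNatExt.mu, p ∈ GaussNatExt.dom) ∧
    -- `mu` is invariant under the partially defined map `T`
    MeasurePreserving GaussNatExt.T
      (GaussNatExt.mu.comap (Subtype.val : GaussNatExt.dom → GaussNatExt.U)) GaussNatExt.mu ∧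
    -- almost invariant measurable sets are trivial
    (∀ A : Set GaussNatExt.U, MeasurableSet A →
      (∀ᵐ p ∂(GaussNatExt.mu.comap (Subtype.val : GaussNatExt.dom → GaussNatExt.U)),
        (GaussNatExt.T p ∈ A ↔ (p : GaussNatExt.U) ∈ A)) →
      GaussNatExt.mu A = 0 ∨ GaussNatExt.mu A = 1) ∧
    -- the same in one phrase, for `T` completed on the null set where it is not defined
    Ergodic GaussNatExt.Ttotal GaussNatExt.mu :=
  ⟨GaussNatExt.isProbabilityMeasure_mu, GaussNatExt.ae_mem_dom, GaussNatExt.measurePreserving_T,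
    fun _ => GaussNatExt.measure_eq_zero_or_one_of_ae_invariant, GaussNatExt.ergodic_Ttotal⟩
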